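/- Let $\mathscr T=(V,\mathcal E)$ be a countable, leafless, rootless directed tree: a directed graph without loops and circuits, connected when directions are ignored, in which every vertex has exactly one parent and at least one child. Let $V_\prec$ be the set of vertices with at least two children; assume that $V_\prec\neq\emptyset$ and that $\mathscr T$ has finite branching index, i.e. there is $m\ge 0$ such that for all $k\ge m$ no vertex of $V_\prec$ is a $k$-th generation descendant of a vertex of $V_\prec$. Let $\lambda=\{\lambda_v\}_{v\in V}$ be positive numbers such that the weighted shift $(S_\lambda f)(v)=\lambda_v f(\mathsf{par}(v))$ is a bounded left-invertible operator on $\ell^2(V)$. By an analytic model of $S_\lambda$ we mean the following data: a Hilbert space $\mathscr H$ of holomorphic functions on a disc in $\mathbb C$ with values in some complex Hilbert space, and a Hilbert space $\mathcal H$ of scalar-valued holomorphic functions on a disc in $\mathbb C$, such that the multiplications by the coordinate functions are bounded operators $\mathscr M_z$ on $\mathscr H$ and $M_t$ on $\mathcal H$; and vectors $f\in\ker\mathscr M_z^*\setminus\{0\}$, $g\in\ker M_t^*\setminus\{0\}$ such that $S_\lambda$ is unitarily equivalent to $$\begin{bmatrix}\mathscr M_z & f\otimes g\\ 0 & M_t^*\end{bmatrix}\quad\text{on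 }\mathscr H\oplus\mathcal H,\qquad (f\otimes g)(h)=\langle h,g\rangle f .$$ Then an analytic model of $S_\lambda$ exists (it can be chosen with both discs centred at $0$ and with all point evaluations on $\mathscr H$ and on $\mathcal H$ continuous), and for every analytic model of $S_\lambda$ one has $$\sigma_e(S_\lambda)=\sigma_e(\mathscr M_z)\cup\sigma_e(M_t^*),$$ where $\sigma_e(T)$ is the set of $w\in\mathbb C$ such that $T-w$ is not Fredholm. If, in addition, $S_\lambda$ is Fredholm, then so are $\mathscr M_z$ and $M_t$, and $\operatorname{ind}S_\lambda=\operatorname{ind}\mathscr M_z+1$, where $\operatorname{ind}T=\dim\ker T-\dim\operatorname{coker}T$. -/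

import Mathlib

universe u v₁ v₂ v₃

namespace RootlessShift

/-! ### Directed trees -/

section Trees

variable {V : Type*}

/-- The digraph `G` is a directed tree: it is non-empty, has no edge from a vertex to itself, has
no circuit (a finite sequence `v 0, …, v (n - 1)` of `n ≥ 2` distinct vertices, each joined to the
next one and the last one to the first), is connected (when directions are ignored), and every
vertex which is not a root has exactly one parent. -/
structure IsDirectedTree (G : Digraph V) : Prop where
  nonempty : Nonempty V
  irrefl : ∀ v, ¬ G.Adj v v
  no_circuit : ∀ (n : ℕ) (v : ℕ → V), 2 ≤ n → Set.InjOn v (Set.Iio n) →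
    (∀ i, i + 1 < n → G.Adj (v i) (v (i + 1))) → ¬ G.Adj (v (n - 1)) (v 0)
  connected : ∀ u v, Relation.ReflTransGen (fun a b => G.Adj a b ∨ G.Adj b a) u v
  parent_unique : ∀ u u' v, G.Adj u v → G.Adj u' v → u = u'

/-- The set of children of the vertices in `W`. -/
def childSet (G : Digraph V) (W : Set V) : Set V := {v | ∃ u ∈ W, G.Adj u v}

/-- The set of `n`-th generation descendants of the vertices in `W`. -/
def childN (G : Digraph V) (n : ℕ) (W : Set V) : Set V := (childSet G)^[n] W

/-- Every vertex has at least one child. -/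
def IsLeafless (G : Digraph V) : Prop := ∀ u, ∃ v, G.Adj u v

/-- No vertex is a root. -/
def IsRootless (G : Digraph V) : Prop := ∀ v, ∃ u, G.Adj u v

/-- The set of branching vertices, that is, of the vertices with at least two children. -/
def branchingSet (G : Digraph V) : Set V := {u | 2 ≤ (childSet G {u}).encard}

/-- A rootless tree has finite branching index if, for some `m`, no branching vertex is a `k`-th
generation descendant of a branching vertex with `k ≥ m`. (The branching index is then the smallest
such `m`.) -/
def HasFiniteBranchingIndex (G : Digraph V) : Prop :=
  ∃ m : ℕ, ∀ k, m ≤ k → childN G k (branchingSet G) ∩ branchingSet G = ∅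

end Trees

/-! ### Weighted shifts -/

/-- The Hilbert space of square summable complex functions on `V`. -/
noncomputable abbrev L2 (V : Type*) := lp (fun _ : V => ℂ) 2

open Classical in
/-- The formal weighted shift: `(Λ f)(v) = lam v * f (parent of v)` if `v` has a parent, and
`(Λ f)(v) = 0` if `v` is a root. -/
noncomputable def shiftFun {V : Type*} (G : Digraph V) (lam : V → ℝ) (f : V → ℂ) (v : V) : ℂ :=
  if h : ∃ u, G.Adj u v then (lam v : ℂ) * f h.choose else 0

/-- `S` is the weighted shift with weights `lam`, as an everywhere defined bounded operator. -/
def IsWeightedShift {V : Type*} (G : Digraph V) (lam : V → ℝ) (S : L2 V →L[ℂ] L2 V) : Prop :=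
  ∀ (f : L2 V) (v : V), S f v = shiftFun G lam f v

/-! ### Operators on Hilbert spaces -/

section Operators

variable {H K : Type*} [NormedAddCommGroup H] [InnerProductSpace ℂ H]
  [NormedAddCommGroup K] [InnerProductSpace ℂ K]

/-- `T` has a bounded left inverse. -/
def IsLeftInvertible (T : H →L[ℂ] H) : Prop := ∃ R : H →L[ℂ] H, R ∘L T = ContinuousLinearMap.id ℂ H

/-- The essential spectrum: the set of `w` such that `T - w` is not Fredholm. -/
def essentialSpectrum (T : H →L[ℂ] H) : Set ℂ :=
  {w | ¬ (T - w • ContinuousLinearMap.id ℂ H).IsFredholm}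

/-- The Fredholm index `dim ker T - dim coker T`. -/
noncomputable def fredholmIndex (T : H →L[ℂ] H) : ℤ := (T : H →ₗ[ℂ] H).index

/-- `S` and `T` are unitarily equivalent. -/
def UnitarilyEquivalent (S : H →L[ℂ] H) (T : K →L[ℂ] K) : Prop :=
  ∃ U : H ≃ₗᵢ[ℂ] K, ∀ x, U (S x) = T (U x)

/-- The operator with block matrix `[[A, C], [0, D]]` on the Hilbert space direct sum `H ⊕ K`. -/
noncomputable def blockUpper (A : H →L[ℂ] H) (C : K →L[ℂ] H) (D : K →L[ℂ] K) :
    WithLp 2 (H × K) →L[ℂ] WithLp 2 (H × K) :=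
  ((WithLp.prodContinuousLinearEquiv 2 ℂ H K).symm : H × K →L[ℂ] WithLp 2 (H × K)) ∘L
    (A ∘L WithLp.fstL 2 ℂ H K + C ∘L WithLp.sndL 2 ℂ H K).prod (D ∘L WithLp.sndL 2 ℂ H K)

end Operators

/-! ### Hilbert spaces of holomorphic functions on a disc -/

/-- A realization of `H` as a space of `E`-valued holomorphic functions on the disc with centre `c`
and radius `r > 0`: every `h : H` gives the function `toFun h`, which is only looked at on the disc;
it is holomorphic there, depends linearly on `h`, and determines `h`. -/
structure HolomorphicRealization (E H : Type*) [NormedAddCommGroup E] [InnerProductSpace ℂ E]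
    [NormedAddCommGroup H] [InnerProductSpace ℂ H] (c : ℂ) (r : ℝ) where
  toFun : H →ₗ[ℂ] (ℂ → E)
  radius_pos : 0 < r
  holomorphic : ∀ h, DifferentiableOn ℂ (toFun h) (Metric.ball c r)
  injective : ∀ h, (∀ z ∈ Metric.ball c r, toFun h z = 0) → h = 0

namespace HolomorphicRealization

variable {E H : Type*} [NormedAddCommGroup E] [InnerProductSpace ℂ E]
  [NormedAddCommGroup H] [InnerProductSpace ℂ H] {c : ℂ} {r : ℝ}

/-- `M` is the operator of multiplication by the coordinate function. -/
def IsMulCoord (ρ : HolomorphicRealization E H c r) (M : H →L[ℂ] H) : Prop :=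
  ∀ h, ∀ z ∈ Metric.ball c r, ρ.toFun (M h) z = z • ρ.toFun h z

/-- The points of the disc are bounded point evaluations, that is, `H` is a reproducing kernel
Hilbert space. -/
def HasBoundedEvaluations (ρ : HolomorphicRealization E H c r) : Prop :=
  ∀ z ∈ Metric.ball c r, Continuous fun h => ρ.toFun h z

end HolomorphicRealization

/-- The data `Mz` on `H`, `Mt` on `K`, `f`, `g` form an analytic model of `S`: `Mz` and `Mt` are
the multiplications by the coordinate on the Hilbert spaces of holomorphic functions `H`
(vector-valued) and `K` (scalar-valued), `f` and `g` are non-zero elements of `ker Mz*` and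
`ker Mt*`, and `S` is unitarily equivalent to `[[Mz, f ⊗ g], [0, Mt*]]` on `H ⊕ K`, where
`(f ⊗ g) y = ⟨y, g⟩ f`. -/
structure IsAnalyticModel {L E H K : Type*}
    [NormedAddCommGroup L] [InnerProductSpace ℂ L]
    [NormedAddCommGroup E] [InnerProductSpace ℂ E]
    [NormedAddCommGroup H] [InnerProductSpace ℂ H] [CompleteSpace H]
    [NormedAddCommGroup K] [InnerProductSpace ℂ K] [CompleteSpace K]
    {c d : ℂ} {r s : ℝ} (S : L →L[ℂ] L)
    (ρ : HolomorphicRealization E H c r) (τ : HolomorphicRealization ℂ K d s)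
    (Mz : H →L[ℂ] H) (Mt : K →L[ℂ] K) (f : H) (g : K) : Prop where
  mulCoord_z : ρ.IsMulCoord Mz
  mulCoord_t : τ.IsMulCoord Mt
  f_ne_zero : f ≠ 0
  f_mem_ker : ContinuousLinearMap.adjoint Mz f = 0
  g_ne_zero : g ≠ 0
  g_mem_ker : ContinuousLinearMap.adjoint Mt g = 0
  equiv : UnitarilyEquivalent S
    (blockUpper Mz (InnerProductSpace.rankOne ℂ f g) (ContinuousLinearMap.adjoint Mt))

end RootlessShift

/-! Existence. Finite branching index gives a branching vertex ω whose proper ancestors all have one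
child. By connectedness, `V` splits into the descendants of ω and the chain of its proper ancestors.
The functions supported on the descendants form an `S`-invariant subspace, and the only edge from
the chain into the descendants is `par ω → ω`, so the corner of `S` has rank one
(`corner_eq_rankOne`). On the chain `S` compresses to a backward weighted shift, whose adjoint is a
forward shift. Both diagonal blocks become multiplications through one device,
`resolventRealization`: if `L T = 1` and `P T = 0`, then `h ↦ P (1 - z L)⁻¹ h` turns `T` into
multiplication by `z`; it is injective as soon as the maps `P L ^ n` separate points.

Arbitrary models. The tree now enters only through injectivity of `S`. A finite-rank corner does not
affect Fredholmness, and a diagonal operator is Fredholm exactly when its entries are; this settles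
the essential spectrum. For the index, `S`, `Mz` and `Mt` are injective, so indices are minus
codimensions of ranges. In the Fredholm case `Mt*` is onto, and the corner adds to the range of `Mz`
the one new direction `f ⊥ ran Mz`: the codimension drops by one
(`finrank_quotient_range_blockUpper`). -/

namespace RootlessShift

open ContinuousLinearMap Filter Topology
open scoped LinearMap.FiniteRangeSetoid

/-! ### Fredholm theory of triangular block operators -/

section Operators

variable {H K : Type*} [NormedAddCommGroup H] [InnerProductSpace ℂ H]
  [NormedAddCommGroup K] [InnerProductSpace ℂ K]

@[simp]
lemma fst_blockUpper_apply (A : H →L[ℂ] H) (C : K →L[ℂ] H) (D : K →L[ℂ] K)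
    (x : WithLp 2 (H × K)) : (blockUpper A C D x).fst = A x.fst + C x.snd := rfl

@[simp]
lemma snd_blockUpper_apply (A : H →L[ℂ] H) (C : K →L[ℂ] H) (D : K →L[ℂ] K)
    (x : WithLp 2 (H × K)) : (blockUpper A C D x).snd = D x.snd := rfl

lemma prodLp_ext {X Y : Type*} {x y : WithLp 2 (X × Y)} (h₁ : x.fst = y.fst) (h₂ : x.snd = y.snd) : x = y := by
  obtain ⟨x⟩ := x
  obtain ⟨y⟩ := y
  exact congrArg _ (Prod.ext h₁ h₂)

lemma blockUpper_sub_smul_id (A : H →L[ℂ] H) (C : K →L[ℂ] H) (D : K →L[ℂ] K) (w : ℂ) :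
    blockUpper A C D - w • ContinuousLinearMap.id ℂ _ =
      blockUpper (A - w • ContinuousLinearMap.id ℂ H) C (D - w • ContinuousLinearMap.id ℂ K) := by
  ext1 x
  apply prodLp_ext
  · simp; abel
  · simp

lemma isQuasiInverse_iff {E F : Type*} [AddCommGroup E] [Module ℂ E] [AddCommGroup F]
    [Module ℂ F] {u : F →ₗ[ℂ] E} {v : E →ₗ[ℂ] F} :
    u.IsQuasiInverse v ↔
      (u ∘ₗ v - .id).HasFiniteRange ∧ (v ∘ₗ u - .id).HasFiniteRange := by
  rw [← LinearMap.FiniteRangeSetoid.equiv_iff_hasFiniteRange,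
    ← LinearMap.FiniteRangeSetoid.equiv_iff_hasFiniteRange]
  rfl

lemma hasFiniteRange_of_forall_eq {E F : Type*} [AddCommGroup E] [Module ℂ E] [AddCommGroup F]
    [Module ℂ F] {u v : E →ₗ[ℂ] F} (hv : v.HasFiniteRange) (h : ∀ x, u x = v x) :
    u.HasFiniteRange :=
  (LinearMap.ext h : u = v) ▸ hv

/-- The diagonal block operator has the same quasi-inverses as the triangular one with a
finite-rank corner. -/
lemma isFredholm_blockUpper_iff_zero (A : H →L[ℂ] H) {C : K →L[ℂ] H} (D : K →L[ℂ] K)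
    (hC : (C : K →ₗ[ℂ] H).HasFiniteRange) :
    (blockUpper A C D).IsFredholm ↔ (blockUpper A 0 D).IsFredholm := by
  have hequiv : (blockUpper A C D : WithLp 2 (H × K) →ₗ[ℂ] WithLp 2 (H × K)) ≈
      (blockUpper A 0 D : WithLp 2 (H × K) →ₗ[ℂ] WithLp 2 (H × K)) := by
    rw [LinearMap.FiniteRangeSetoid.equiv_iff_hasFiniteRange]
    have hfac : (blockUpper A C D : WithLp 2 (H × K) →ₗ[ℂ] WithLp 2 (H × K)) -
        (blockUpper A 0 D : WithLp 2 (H × K) →ₗ[ℂ] WithLp 2 (H × K)) =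
        ((WithLp.linearEquiv 2 ℂ (H × K)).symm : H × K →ₗ[ℂ] WithLp 2 (H × K)) ∘ₗ
          LinearMap.inl ℂ H K ∘ₗ (C : K →ₗ[ℂ] H) ∘ₗ
            (WithLp.sndL 2 ℂ H K : WithLp 2 (H × K) →ₗ[ℂ] K) := by
      ext1 x
      apply prodLp_ext
      · simp
      · simp
    rw [hfac]
    exact ((hC.comp_right _).comp_left _).comp_left _
  rw [isFredholm_iff_exists_isQuasiInverse, isFredholm_iff_exists_isQuasiInverse]
  exact exists_congr fun T => LinearMap.isQuasiInverse_congr (Setoid.refl _) (Setoid.symm hequiv)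

/-- The inclusions and projections of the two summands intertwine the diagonal operator with its
entries. Hence the diagonal corners of a quasi-inverse are quasi-inverses of `A` and `D`, and
conversely two quasi-inverses combine diagonally. -/
lemma isFredholm_blockUpper_zero_iff (A : H →L[ℂ] H) (D : K →L[ℂ] K) :
    (blockUpper A 0 D).IsFredholm ↔ A.IsFredholm ∧ D.IsFredholm := by
  simp only [isFredholm_iff_exists_isQuasiInverse, isQuasiInverse_iff]
  let i : H →L[ℂ] WithLp 2 (H × K) :=
    ((WithLp.prodContinuousLinearEquiv 2 ℂ H K).symm : H × K →L[ℂ] WithLp 2 (H × K)) ∘L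
      ContinuousLinearMap.inl ℂ H K
  let j : K →L[ℂ] WithLp 2 (H × K) :=
    ((WithLp.prodContinuousLinearEquiv 2 ℂ H K).symm : H × K →L[ℂ] WithLp 2 (H × K)) ∘L
      ContinuousLinearMap.inr ℂ H K
  let p : WithLp 2 (H × K) →L[ℂ] H := WithLp.fstL 2 ℂ H K
  let q : WithLp 2 (H × K) →L[ℂ] K := WithLp.sndL 2 ℂ H K
  constructor
  · rintro ⟨T, h₁, h₂⟩
    refine ⟨⟨p ∘L T ∘L i, ?_, ?_⟩, ⟨q ∘L T ∘L j, ?_, ?_⟩⟩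
    · refine hasFiniteRange_of_forall_eq
        ((h₁.comp_right (i : H →ₗ[ℂ] _)).comp_left (p : _ →ₗ[ℂ] H)) fun x => ?_
      have : i (A x) = blockUpper A (0 : K →L[ℂ] H) D (i x) := by
        apply prodLp_ext <;> simp [i]
      simp only [LinearMap.sub_apply, LinearMap.comp_apply, coe_coe, coe_comp, Function.comp_apply,
        this, LinearMap.id_apply, map_sub]
      simp [i, p]
    · refine hasFiniteRange_of_forall_eq
        ((h₂.comp_right (i : H →ₗ[ℂ] _)).comp_left (p : _ →ₗ[ℂ] H)) fun x => ?_
      simp [i, p]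
    · refine hasFiniteRange_of_forall_eq
        ((h₁.comp_right (j : K →ₗ[ℂ] _)).comp_left (q : _ →ₗ[ℂ] K)) fun x => ?_
      have : j (D x) = blockUpper A (0 : K →L[ℂ] H) D (j x) := by
        apply prodLp_ext <;> simp [j]
      simp only [LinearMap.sub_apply, LinearMap.comp_apply, coe_coe, coe_comp, Function.comp_apply,
        this, LinearMap.id_apply, map_sub]
      simp [j, q]
    · refine hasFiniteRange_of_forall_eq
        ((h₂.comp_right (j : K →ₗ[ℂ] _)).comp_left (q : _ →ₗ[ℂ] K)) fun x => ?_
      simp [j, q]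
  · rintro ⟨⟨A', hA₁, hA₂⟩, ⟨D', hD₁, hD₂⟩⟩
    have key : ∀ (X : H →ₗ[ℂ] H) (Y : K →ₗ[ℂ] K), X.HasFiniteRange → Y.HasFiniteRange →
        ((i : H →ₗ[ℂ] WithLp 2 (H × K)) ∘ₗ X ∘ₗ (p : WithLp 2 (H × K) →ₗ[ℂ] H) +
          (j : K →ₗ[ℂ] WithLp 2 (H × K)) ∘ₗ Y ∘ₗ
            (q : WithLp 2 (H × K) →ₗ[ℂ] K)).HasFiniteRange := fun _ _ hX hY =>
      ((hX.comp_right _).comp_left _).add ((hY.comp_right _).comp_left _)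
    refine ⟨blockUpper A' 0 D', ?_, ?_⟩
    · refine hasFiniteRange_of_forall_eq (key _ _ hA₁ hD₁) fun x => ?_
      apply prodLp_ext <;> simp [i, j, p, q]
    · refine hasFiniteRange_of_forall_eq (key _ _ hA₂ hD₂) fun x => ?_
      apply prodLp_ext <;> simp [i, j, p, q]

/-- A block upper triangular operator with finite-rank corner is Fredholm if and only if its
diagonal entries are. -/
lemma isFredholm_blockUpper_iff (A : H →L[ℂ] H) {C : K →L[ℂ] H} (D : K →L[ℂ] K)
    (hC : (C : K →ₗ[ℂ] H).HasFiniteRange) :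
    (blockUpper A C D).IsFredholm ↔ A.IsFredholm ∧ D.IsFredholm := by
  rw [isFredholm_blockUpper_iff_zero A D hC, isFredholm_blockUpper_zero_iff]

lemma essentialSpectrum_blockUpper (A : H →L[ℂ] H) {C : K →L[ℂ] H} (D : K →L[ℂ] K)
    (hC : (C : K →ₗ[ℂ] H).HasFiniteRange) :
    essentialSpectrum (blockUpper A C D) = essentialSpectrum A ∪ essentialSpectrum D := by
  ext w
  simp only [essentialSpectrum, Set.mem_ofPred_eq, Set.mem_union, blockUpper_sub_smul_id,
    isFredholm_blockUpper_iff _ _ hC]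
  tauto

lemma hasFiniteRange_rankOne (f : H) (g : K) :
    (InnerProductSpace.rankOne ℂ f g : K →ₗ[ℂ] H).HasFiniteRange := by
  have h : (InnerProductSpace.rankOne ℂ f g : K →ₗ[ℂ] H) =
      LinearMap.toSpanSingleton ℂ H f ∘ₗ (innerSL ℂ g : K →ₗ[ℂ] ℂ) := by
    ext; simp
  rw [h]
  exact LinearMap.HasFiniteRange.comp_right LinearMap.HasFiniteRange.of_finite_dom _

lemma UnitarilyEquivalent.symm {S : H →L[ℂ] H} {T : K →L[ℂ] K} (h : UnitarilyEquivalent S T) :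
    UnitarilyEquivalent T S := by
  obtain ⟨U, hU⟩ := h
  exact ⟨U.symm, fun x => by rw [U.symm_apply_eq, hU, U.apply_symm_apply]⟩

lemma UnitarilyEquivalent.sub_smul_id {S : H →L[ℂ] H} {T : K →L[ℂ] K}
    (h : UnitarilyEquivalent S T) (w : ℂ) :
    UnitarilyEquivalent (S - w • ContinuousLinearMap.id ℂ H)
      (T - w • ContinuousLinearMap.id ℂ K) := by
  obtain ⟨U, hU⟩ := h
  exact ⟨U, fun x => by simp [hU]⟩

lemma UnitarilyEquivalent.isFredholm {S : H →L[ℂ] H} {T : K →L[ℂ] K}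
    (h : UnitarilyEquivalent S T) (hS : S.IsFredholm) : T.IsFredholm := by
  obtain ⟨U, hU⟩ := h
  rw [isFredholm_iff_exists_isQuasiInverse] at hS ⊢
  obtain ⟨R, hR⟩ := hS
  rw [isQuasiInverse_iff] at hR
  refine ⟨(U : H →L[ℂ] K) ∘L R ∘L (U.symm : K →L[ℂ] H), isQuasiInverse_iff.2 ⟨?_, ?_⟩⟩
  · refine hasFiniteRange_of_forall_eq ((hR.1.comp_right (U.symm : K →ₗ[ℂ] H)).comp_left
      (U : H →ₗ[ℂ] K)) fun x => ?_
    have : U.symm (T x) = S (U.symm x) := by rw [U.symm_apply_eq, hU, U.apply_symm_apply]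
    simp [this]
  · refine hasFiniteRange_of_forall_eq ((hR.2.comp_right (U.symm : K →ₗ[ℂ] H)).comp_left
      (U : H →ₗ[ℂ] K)) fun x => ?_
    simp [hU]

lemma UnitarilyEquivalent.isFredholm_iff {S : H →L[ℂ] H} {T : K →L[ℂ] K}
    (h : UnitarilyEquivalent S T) : S.IsFredholm ↔ T.IsFredholm :=
  ⟨h.isFredholm, h.symm.isFredholm⟩

lemma UnitarilyEquivalent.essentialSpectrum_eq {S : H →L[ℂ] H} {T : K →L[ℂ] K}
    (h : UnitarilyEquivalent S T) : essentialSpectrum S = essentialSpectrum T := by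
  ext w
  simp only [essentialSpectrum, Set.mem_ofPred_eq, (h.sub_smul_id w).isFredholm_iff]

lemma UnitarilyEquivalent.injective {S : H →L[ℂ] H} {T : K →L[ℂ] K}
    (h : UnitarilyEquivalent S T) (hS : Function.Injective S) : Function.Injective T := by
  obtain ⟨U, hU⟩ := h
  intro x y hxy
  apply U.symm.injective
  apply hS
  apply U.injective
  simpa [hU] using hxy

lemma UnitarilyEquivalent.fredholmIndex_eq {S : H →L[ℂ] H} {T : K →L[ℂ] K}
    (h : UnitarilyEquivalent S T) (hS : Function.Injective S) :
    fredholmIndex S = fredholmIndex T := by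
  have hT := h.injective hS
  obtain ⟨U, hU⟩ := h
  unfold fredholmIndex
  rw [LinearMap.index_of_injective (f := (S : H →ₗ[ℂ] H)) hS,
    LinearMap.index_of_injective (f := (T : K →ₗ[ℂ] K)) hT]
  congr 2
  refine (Submodule.Quotient.equiv _ _ U.toLinearEquiv ?_).finrank_eq
  ext y
  constructor
  · rintro ⟨_, ⟨x, rfl⟩, rfl⟩
    exact ⟨U x, (hU x).symm⟩
  · rintro ⟨x, rfl⟩
    exact ⟨S (U.symm x), ⟨U.symm x, rfl⟩, by simp [hU]⟩

/-- If the second diagonal entry `D` is surjective, the corner is `f ⊗ g` with `g` a non-zero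
vector of `ker D` and `f ∉ ran A`, then passing from `A` to the block operator lowers the
codimension of the range by one. -/
lemma finrank_quotient_range_blockUpper (A : H →L[ℂ] H) (D : K →L[ℂ] K) {f : H} {g : K}
    (hD : Function.Surjective D) (hg : D g = 0) (hg₀ : g ≠ 0) (hf : f ∉ A.range)
    [FiniteDimensional ℂ (H ⧸ A.range)] :
    Module.finrank ℂ (WithLp 2 (H × K) ⧸
        (blockUpper A (InnerProductSpace.rankOne ℂ f g) D).range) + 1 =
      Module.finrank ℂ (H ⧸ A.range) := by
  set T := blockUpper A (InnerProductSpace.rankOne ℂ f g) D with hTdef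
  let φ : H →ₗ[ℂ] (WithLp 2 (H × K) ⧸ T.range) :=
    T.range.mkQ ∘ₗ ((WithLp.linearEquiv 2 ℂ (H × K)).symm : H × K →ₗ[ℂ] WithLp 2 (H × K)) ∘ₗ
      LinearMap.inl ℂ H K
  have hφ : Function.Surjective φ := by
    intro y
    obtain ⟨x, rfl⟩ := Submodule.mkQ_surjective _ y
    obtain ⟨k, hk⟩ := hD x.snd
    -- Since `T (0, k) = (⟨g, k⟩ f, x.snd)`, subtracting it from `x` removes the second coordinate
    -- without changing the class.
    refine ⟨x.fst - inner ℂ g k • f, ?_⟩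
    rw [← sub_eq_zero]
    change T.range.mkQ _ - _ = 0
    rw [← map_sub, Submodule.mkQ_apply, Submodule.Quotient.mk_eq_zero]
    refine ⟨WithLp.toLp 2 (0, -k), ?_⟩
    apply prodLp_ext <;> simp [hTdef, hk]
  have hker : φ.ker = A.range ⊔ ℂ ∙ f := by
    ext h
    have h1 : h ∈ φ.ker ↔ WithLp.toLp 2 (h, (0 : K)) ∈ T.range :=
      Submodule.Quotient.mk_eq_zero _
    rw [h1, Submodule.mem_sup]
    constructor
    · rintro ⟨x, hx⟩
      refine ⟨A x.fst, ⟨_, rfl⟩, inner ℂ g x.snd • f,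
        Submodule.smul_mem _ _ (Submodule.mem_span_singleton_self f), ?_⟩
      simpa [hTdef] using congrArg WithLp.fst hx
    · rintro ⟨_, ⟨x, rfl⟩, y, hy, rfl⟩
      obtain ⟨a, rfl⟩ := Submodule.mem_span_singleton.1 hy
      -- As `D g = 0`, a multiple of `g` in the second slot contributes only a multiple of `f`; the
      -- scaling makes it `a • f`.
      refine ⟨WithLp.toLp 2 (x, (a / inner ℂ g g) • g), ?_⟩
      have : inner ℂ g g ≠ 0 := inner_self_ne_zero.2 hg₀
      apply prodLp_ext
      · change A x + InnerProductSpace.rankOne ℂ f g ((a / inner ℂ g g) • g) = A x + a • f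
        rw [InnerProductSpace.rankOne_apply, inner_smul_right, div_mul_cancel₀ _ this]
      · simp [hTdef, hg]
  -- The cokernel of `T` is the cokernel of `A` modulo the line spanned by the class of `f`, which
  -- is non-zero because `f ∉ ran A`.
  rw [← (φ.quotKerEquivOfSurjective hφ).finrank_eq, hker,
    ← (Submodule.quotientQuotientEquivQuotientSup A.range (ℂ ∙ f)).finrank_eq,
    Submodule.map_span, Set.image_singleton]
  have hf' : A.range.mkQ f ≠ 0 := by
    rwa [Submodule.mkQ_apply, ne_eq, Submodule.Quotient.mk_eq_zero]
  rw [← Submodule.finrank_quotient_add_finrank (ℂ ∙ (A.range.mkQ f)), finrank_span_singleton hf']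

end Operators

/-! ### Adjoints of finite-rank and Fredholm operators -/

section Adjoint

variable {H K : Type*} [NormedAddCommGroup H] [InnerProductSpace ℂ H] [CompleteSpace H]
  [NormedAddCommGroup K] [InnerProductSpace ℂ K] [CompleteSpace K]

/-- `F` is unchanged by the orthogonal projection onto its range `R`, so `F*` factors through the
finite-dimensional space `R`. -/
lemma hasFiniteRange_adjoint {F : H →L[ℂ] K} (hF : (F : H →ₗ[ℂ] K).HasFiniteRange) :
    (adjoint F : K →ₗ[ℂ] H).HasFiniteRange := by
  have : FiniteDimensional ℂ (F : H →ₗ[ℂ] K).range := Module.Finite.of_fg hF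
  let R := (F : H →ₗ[ℂ] K).range
  have hR : F = R.subtypeL ∘L R.orthogonalProjectionOnto ∘L F := by
    ext x
    simp only [coe_comp, Function.comp_apply, Submodule.subtypeL_apply]
    exact (Submodule.starProjection_eq_self_iff.2 (LinearMap.mem_range_self _ x)).symm
  have h₂ : adjoint F =
      (adjoint F ∘L R.subtypeL) ∘L R.orthogonalProjectionOnto := by
    conv_lhs => rw [hR]
    rw [adjoint_comp, adjoint_comp, Submodule.adjoint_subtypeL,
      Submodule.adjoint_orthogonalProjectionOnto]
  rw [h₂]
  exact (LinearMap.HasFiniteRange.of_finite_dom (f := ((adjoint F ∘L R.subtypeL) : R →ₗ[ℂ] H))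
    ).comp_right (R.orthogonalProjectionOnto : K →ₗ[ℂ] R)

lemma isFredholm_adjoint {T : H →L[ℂ] H} (hT : T.IsFredholm) : (adjoint T).IsFredholm := by
  rw [isFredholm_iff_exists_isQuasiInverse] at hT ⊢
  obtain ⟨R, hR⟩ := hT
  rw [isQuasiInverse_iff] at hR
  refine ⟨adjoint R, isQuasiInverse_iff.2 ⟨?_, ?_⟩⟩
  · refine hasFiniteRange_of_forall_eq
      (hasFiniteRange_adjoint (F := T ∘L R - ContinuousLinearMap.id ℂ H) hR.2) fun x => ?_
    simp [adjoint_comp, adjoint_id]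
  · refine hasFiniteRange_of_forall_eq
      (hasFiniteRange_adjoint (F := R ∘L T - ContinuousLinearMap.id ℂ H) hR.1) fun x => ?_
    simp [adjoint_comp, adjoint_id]

lemma isFredholm_adjoint_iff {T : H →L[ℂ] H} : (adjoint T).IsFredholm ↔ T.IsFredholm :=
  ⟨fun h => by simpa using isFredholm_adjoint h, isFredholm_adjoint⟩

/-- The orthogonal complement of `ran T*` is `ker T = 0`, so a closed range must be everything. -/
lemma surjective_adjoint_of_injective {T : H →L[ℂ] H} (hT : Function.Injective T)
    (hcl : IsClosed ((adjoint T : H →L[ℂ] H).range : Set H)) :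
    Function.Surjective (adjoint T) := by
  have : CompleteSpace (adjoint T).range := hcl.completeSpace_coe
  have h : (adjoint T).range = ⊤ := by
    rw [← Submodule.orthogonal_eq_bot_iff, orthogonal_range, adjoint_adjoint]
    exact LinearMap.ker_eq_bot.2 hT
  exact LinearMap.range_eq_top.1 h

end Adjoint

/-! ### Operators as multiplication by the coordinate -/

section Realization

/-- Away from `w` the scalar can be cancelled; at `w` the value is recovered by continuity. -/
lemma eqOn_zero_of_smul_eq_zero {E : Type*} [NormedAddCommGroup E] [NormedSpace ℂ E]
    {F : ℂ → E} {s : Set ℂ} (hs : IsOpen s) (hF : ContinuousOn F s) {w : ℂ}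
    (h : ∀ z ∈ s, (z - w) • F z = 0) : ∀ z ∈ s, F z = 0 := by
  intro z hz
  by_cases hzw : z = w
  · subst hzw
    have h₁ : Tendsto F (𝓝[≠] z) (𝓝 (F z)) :=
      ((hF z hz).continuousAt (hs.mem_nhds hz)).tendsto.mono_left nhdsWithin_le_nhds
    have h₂ : F =ᶠ[𝓝[≠] z] fun _ => 0 := by
      filter_upwards [self_mem_nhdsWithin, mem_nhdsWithin_of_mem_nhds (hs.mem_nhds hz)] with y hy hys
      exact (smul_eq_zero.1 (h y hys)).resolve_left (sub_ne_zero.2 hy)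
    exact tendsto_nhds_unique h₁ (tendsto_const_nhds.congr' h₂.symm)
  · exact (smul_eq_zero.1 (h z hz)).resolve_left (sub_ne_zero.2 hzw)

variable {E H : Type*} [NormedAddCommGroup E] [InnerProductSpace ℂ E]
  [NormedAddCommGroup H] [InnerProductSpace ℂ H]

lemma HolomorphicRealization.IsMulCoord.injective {c : ℂ} {r : ℝ}
    {ρ : HolomorphicRealization E H c r} {M : H →L[ℂ] H} (hM : ρ.IsMulCoord M) :
    Function.Injective M := by
  refine (injective_iff_map_eq_zero M).2 fun h hh => ρ.injective h ?_
  refine eqOn_zero_of_smul_eq_zero (w := 0) Metric.isOpen_ball (ρ.holomorphic h).continuousOn ?_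
  intro z hz
  rw [sub_zero, ← hM h z hz, hh, map_zero, Pi.zero_apply]

/-- The `+ 1` in the radius keeps it positive and finite when `L = 0`, while still forcing `‖z L‖ <
1`. -/
lemma isUnit_one_sub_smul [CompleteSpace H] (L : H →L[ℂ] H) {z : ℂ}
    (hz : z ∈ Metric.ball (0 : ℂ) (‖L‖ + 1)⁻¹) : IsUnit (1 - z • L) := by
  rw [mem_ball_zero_iff, ← one_div, lt_div_iff₀ (by positivity)] at hz
  refine isUnit_one_sub_of_norm_lt_one ((norm_smul_le z L).trans_lt ?_)
  nlinarith [norm_nonneg z]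

/-- This splits off the constant term of the Neumann series. It yields both the multiplication
property and the coefficient extraction behind injectivity. -/
lemma inverse_one_sub_smul_apply [CompleteSpace H] (L : H →L[ℂ] H) {z : ℂ}
    (hz : z ∈ Metric.ball (0 : ℂ) (‖L‖ + 1)⁻¹) (h : H) :
    Ring.inverse (1 - z • L) h = h + z • Ring.inverse (1 - z • L) (L h) := by
  have := congrArg (fun T : H →L[ℂ] H => T h) (Ring.inverse_mul_cancel _ (isUnit_one_sub_smul L hz))
  change Ring.inverse (1 - z • L) (h - z • L h) = h at this
  rw [map_sub, map_smul, sub_eq_iff_eq_add] at this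
  exact this

/-- The realization `h ↦ (z ↦ P (1 - z L)⁻¹ h)` of a Hilbert space, for operators `P` and `L` such
that the family `P L ^ n` separates points. -/
noncomputable def resolventRealization [CompleteSpace H] (L : H →L[ℂ] H) (P : H →L[ℂ] E)
    (hPL : ∀ h, (∀ n : ℕ, P ((L ^ n) h) = 0) → h = 0) :
    HolomorphicRealization E H 0 (‖L‖ + 1)⁻¹ where
  toFun :=
    { toFun := fun h z => P (Ring.inverse (1 - z • L) h)
      map_add' := fun x y => by ext z; simp
      map_smul' := fun a x => by ext z; simp }
  radius_pos := by positivity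
  holomorphic := fun h z hz => by
    have h₁ : DifferentiableAt ℂ (fun z : ℂ => Ring.inverse (1 - z • L)) z := by
      obtain ⟨u, hu⟩ := isUnit_one_sub_smul L hz
      have h₂ : DifferentiableAt ℂ (fun z : ℂ => (1 : H →L[ℂ] H) - z • L) z := by fun_prop
      have h₃ : DifferentiableAt ℂ Ring.inverse ((1 : H →L[ℂ] H) - z • L) := by
        rw [← hu]
        exact (hasFDerivAt_ringInverse u).differentiableAt
      exact h₃.comp z h₂
    exact (P.differentiableAt.comp z
      (h₁.clm_apply (differentiableAt_const h))).differentiableWithinAt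
  injective := fun h hh => by
    set r : ℝ := (‖L‖ + 1)⁻¹
    have hr : (0 : ℂ) ∈ Metric.ball (0 : ℂ) r := Metric.mem_ball_self (by positivity)
    have hcont : ∀ x, ContinuousOn (fun z : ℂ => P (Ring.inverse (1 - z • L) x))
        (Metric.ball (0 : ℂ) r) := fun x z hz => by
      obtain ⟨u, hu⟩ := isUnit_one_sub_smul L hz
      have h₂ : ContinuousAt (fun z : ℂ => (1 : H →L[ℂ] H) - z • L) z := by fun_prop
      have h₃ : ContinuousAt Ring.inverse ((1 : H →L[ℂ] H) - z • L) := by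
        rw [← hu]
        exact NormedRing.inverse_continuousAt u
      have h₄ : ContinuousAt (fun z : ℂ => Ring.inverse ((1 : H →L[ℂ] H) - z • L)) z :=
        ContinuousAt.comp (g := Ring.inverse) (f := fun z : ℂ => (1 : H →L[ℂ] H) - z • L) h₃ h₂
      exact (P.continuous.continuousAt.comp (h₄.clm_apply continuousAt_const)).continuousWithinAt
    have hzero : ∀ x, (∀ z ∈ Metric.ball (0 : ℂ) r, P (Ring.inverse (1 - z • L) x) = 0) →
        P x = 0 := fun x hx => by simpa using hx 0 hr
    -- If the function of `L ^ n h` vanishes, so does its constant term, and what remains is `z`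
    -- times the function of `L ^ (n + 1) h`. Cancelling `z` shows that all coefficients `P L ^ n h`
    -- are zero.
    have hstep : ∀ n : ℕ, ∀ z ∈ Metric.ball (0 : ℂ) r,
        P (Ring.inverse (1 - z • L) ((L ^ n) h)) = 0 := by
      intro n
      induction n with
      | zero => simpa using hh
      | succ n ih =>
        refine eqOn_zero_of_smul_eq_zero (w := 0) Metric.isOpen_ball (hcont _) fun z hz => ?_
        have := ih z hz
        rw [inverse_one_sub_smul_apply L hz, map_add, hzero _ ih, zero_add, map_smul] at this
        rw [sub_zero, pow_succ']
        exact this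
    exact hPL h fun n => hzero _ (hstep n)

lemma resolventRealization_hasBoundedEvaluations [CompleteSpace H] (L : H →L[ℂ] H)
    (P : H →L[ℂ] E) (hPL : ∀ h, (∀ n : ℕ, P ((L ^ n) h) = 0) → h = 0) :
    (resolventRealization L P hPL).HasBoundedEvaluations := fun z _ =>
  (P ∘L Ring.inverse (1 - z • L)).continuous

lemma resolventRealization_isMulCoord [CompleteSpace H] (L : H →L[ℂ] H)
    (P : H →L[ℂ] E) (hPL : ∀ h, (∀ n : ℕ, P ((L ^ n) h) = 0) → h = 0) {T : H →L[ℂ] H}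
    (hLT : ∀ h, L (T h) = h) (hPT : ∀ h, P (T h) = 0) :
    (resolventRealization L P hPL).IsMulCoord T := fun h z hz => by
  change P (Ring.inverse (1 - z • L) (T h)) = z • P (Ring.inverse (1 - z • L) h)
  rw [inverse_one_sub_smul_apply L hz, map_add, hPT, hLT, zero_add, map_smul]

end Realization

/-! ### Essential spectrum and index of an arbitrary model -/

section Model

variable {L E H K : Type*} [NormedAddCommGroup L] [InnerProductSpace ℂ L]
  [NormedAddCommGroup E] [InnerProductSpace ℂ E]
  [NormedAddCommGroup H] [InnerProductSpace ℂ H] [CompleteSpace H]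
  [NormedAddCommGroup K] [InnerProductSpace ℂ K] [CompleteSpace K]
  {c d : ℂ} {r s : ℝ} {S : L →L[ℂ] L}
  {ρ : HolomorphicRealization E H c r} {τ : HolomorphicRealization ℂ K d s}
  {Mz : H →L[ℂ] H} {Mt : K →L[ℂ] K} {f : H} {g : K}

lemma IsAnalyticModel.essentialSpectrum_eq (h : IsAnalyticModel S ρ τ Mz Mt f g) :
    essentialSpectrum S = essentialSpectrum Mz ∪ essentialSpectrum (adjoint Mt) := by
  rw [h.equiv.essentialSpectrum_eq, essentialSpectrum_blockUpper _ _ (hasFiniteRange_rankOne f g)]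

lemma IsAnalyticModel.isFredholm_iff (h : IsAnalyticModel S ρ τ Mz Mt f g) :
    S.IsFredholm ↔ Mz.IsFredholm ∧ Mt.IsFredholm := by
  rw [h.equiv.isFredholm_iff, isFredholm_blockUpper_iff _ _ (hasFiniteRange_rankOne f g),
    isFredholm_adjoint_iff]

lemma IsAnalyticModel.fredholmIndex_eq (h : IsAnalyticModel S ρ τ Mz Mt f g)
    (hinj : Function.Injective S) (hS : S.IsFredholm) :
    fredholmIndex S = fredholmIndex Mz + 1 := by
  obtain ⟨hMz, hMt⟩ := h.isFredholm_iff.1 hS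
  have : FiniteDimensional ℂ (H ⧸ Mz.range) := hMz.finite_coker
  -- A non-zero vector of `ker Mz*` is orthogonal to `ran Mz`, hence not in it.
  have hf : f ∉ Mz.range := by
    rintro ⟨x, hx⟩
    apply h.f_ne_zero
    rw [← inner_self_eq_zero (𝕜 := ℂ)]
    nth_rw 2 [← hx]
    rw [coe_coe, ← adjoint_inner_left, h.f_mem_ker, inner_zero_left]
  have key := finrank_quotient_range_blockUpper Mz (adjoint Mt)
    (surjective_adjoint_of_injective h.mulCoord_t.injective (isFredholm_adjoint hMt).isClosed_range)
    h.g_mem_ker h.g_ne_zero hf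
  rw [h.equiv.fredholmIndex_eq hinj]
  unfold fredholmIndex
  rw [LinearMap.index_of_injective (f := (Mz : H →ₗ[ℂ] H)) h.mulCoord_z.injective,
    LinearMap.index_of_injective (h.equiv.injective hinj), ← key]
  push_cast
  ring

end Model

end RootlessShift

namespace RootlessShift

open ContinuousLinearMap

/-! ### The generalized root of a rootless tree -/

section Trees

variable {V : Type*} {G : Digraph V} {par : V → V}

/-- `par` maps each vertex of the rootless tree to its parent. -/
def IsParentMap (G : Digraph V) (par : V → V) : Prop := ∀ u v, G.Adj u v ↔ u = par v

lemma IsDirectedTree.exists_isParentMap (hT : IsDirectedTree G) (hG : IsRootless G) :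
    ∃ par, IsParentMap G par := by
  choose par hpar using hG
  exact ⟨par, fun u v => ⟨fun h => hT.parent_unique _ _ _ h (hpar v), fun h => h ▸ hpar v⟩⟩

lemma IsParentMap.mem_childSet (hp : IsParentMap G par) {W : Set V} {v : V} :
    v ∈ childSet G W ↔ par v ∈ W :=
  ⟨fun ⟨_, hu, huv⟩ => (hp _ _).1 huv ▸ hu, fun h => ⟨_, h, (hp _ _).2 rfl⟩⟩

lemma IsParentMap.mem_childN (hp : IsParentMap G par) (n : ℕ) {W : Set V} {v : V} :
    v ∈ childN G n W ↔ par^[n] v ∈ W := by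
  unfold childN
  induction n generalizing v with
  | zero => rfl
  | succ n ih => rw [Function.iterate_succ_apply', hp.mem_childSet, ih, Function.iterate_succ_apply]

lemma IsParentMap.mem_branchingSet (hp : IsParentMap G par) {a b : V} (hab : par a = par b)
    (hne : a ≠ b) : par a ∈ branchingSet G := by
  have h : 1 < (childSet G {par a}).encard :=
    Set.one_lt_encard_iff.2 ⟨a, b, hp.mem_childSet.2 rfl, hp.mem_childSet.2 hab.symm, hne⟩
  simpa only [one_add_one_eq_two] using! Order.add_one_le_of_lt h

/-- A periodic vertex would trace, over one minimal period, a loop (period one) or a circuit of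
distinct vertices. -/
lemma IsDirectedTree.iterate_parent_ne (hT : IsDirectedTree G) (hp : IsParentMap G par) (v : V)
    (n : ℕ) : par^[n + 1] v ≠ v := by
  intro h
  have hpos : 0 < Function.minimalPeriod par v :=
    Function.IsPeriodicPt.minimalPeriod_pos n.succ_pos h
  have hper : par^[Function.minimalPeriod par v] v = v := Function.iterate_minimalPeriod
  have hinj := Function.iterate_injOn_Iio_minimalPeriod (f := par) (x := v)
  set p := Function.minimalPeriod par v
  rcases Nat.lt_or_ge p 2 with hlt | hge
  · have hp1 : p = 1 := by omega
    rw [hp1] at hper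
    exact hT.irrefl v ((hp v v).2 hper.symm)
  -- The orbit is run backwards because edges point from parent to child.
  · refine hT.no_circuit p (fun i => par^[p - 1 - i] v) hge ?_ ?_ ?_
    · intro i hi j hj hij
      simp only [Set.mem_Iio] at hi hj
      have := hinj (by simp only [Set.mem_Iio]; omega) (by simp only [Set.mem_Iio]; omega) hij
      omega
    · intro i hi
      rw [hp, ← Function.iterate_succ_apply' par]
      congr 2
      omega
    · rw [hp, ← Function.iterate_succ_apply' par]
      simp only [Nat.sub_self, Nat.sub_zero, Nat.succ_eq_add_one, Nat.sub_add_cancel hpos, hper,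
        Function.iterate_zero, id_eq]

lemma IsDirectedTree.exists_common_ancestor (hT : IsDirectedTree G) (hp : IsParentMap G par)
    (u v : V) : ∃ i j, par^[i] u = par^[j] v := by
  induction hT.connected u v with
  | refl => exact ⟨0, 0, rfl⟩
  | tail _ hbc ih =>
    obtain ⟨i, j, hij⟩ := ih
    rcases hbc with h | h
    · refine ⟨i, j + 1, ?_⟩
      rw [Function.iterate_succ_apply, ← (hp _ _).1 h, hij]
    · refine ⟨i + 1, j, ?_⟩
      rw [Function.iterate_succ_apply', hij, ← Function.iterate_succ_apply' par,
        Function.iterate_succ_apply, ← (hp _ _).1 h]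

/-- `ω` is a generalized root: the tree consists of the descendants of `ω` and of the proper
ancestors of `ω`, and each of the latter has only one child. -/
structure IsGeneralizedRoot (par : V → V) (ω : V) : Prop where
  iterate_ne : ∀ n, par^[n + 1] ω ≠ ω
  eq_of_parent_eq : ∀ n v, par v = par^[n + 1] ω → v = par^[n] ω
  cover : ∀ v, (∃ n, par^[n] v = ω) ∨ ∃ n, v = par^[n + 1] ω

/-- The finite branching index bounds how far above a branching vertex another one can occur, so the
highest branching ancestor of a given `v₀` exists. Every vertex above it has a single child. -/
lemma IsDirectedTree.exists_isGeneralizedRoot (hT : IsDirectedTree G) (hp : IsParentMap G par)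
    (hb : (branchingSet G).Nonempty) (hfin : HasFiniteBranchingIndex G) :
    ∃ ω, IsGeneralizedRoot par ω := by
  classical
  obtain ⟨v₀, hv₀⟩ := hb
  obtain ⟨m, hm⟩ := hfin
  have hbound : ∀ i, par^[i] v₀ ∈ branchingSet G → i ≤ m := by
    intro i hi
    by_contra hlt
    have : v₀ ∈ childN G i (branchingSet G) ∩ branchingSet G := ⟨(hp.mem_childN i).2 hi, hv₀⟩
    rw [hm i (by omega)] at this
    exact this
  -- By `hbound` the cut-off `m` misses no branching ancestor.
  set i₀ := Nat.findGreatest (fun i => par^[i] v₀ ∈ branchingSet G) m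
  have hnot : ∀ n, par^[n + 1] (par^[i₀] v₀) ∉ branchingSet G := by
    intro n hn
    rw [← Function.iterate_add_apply] at hn
    have := Nat.le_findGreatest (P := fun i => par^[i] v₀ ∈ branchingSet G) (hbound _ hn) hn
    omega
  have huniq : ∀ n v, par v = par^[n + 1] (par^[i₀] v₀) → v = par^[n] (par^[i₀] v₀) := by
    intro n v hv
    by_contra hne
    apply hnot n
    rw [← hv]
    exact hp.mem_branchingSet (by rw [hv, Function.iterate_succ_apply']) hne
  refine ⟨par^[i₀] v₀, fun n => hT.iterate_parent_ne hp _ n, huniq, fun v => ?_⟩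
  -- Take the first vertex on the line above the root that is an ancestor of `v`, or `v` itself. If
  -- it is strictly above both the root and `v`, uniqueness of its child lets both paths be
  -- shortened, against minimality.
  have hex := hT.exists_common_ancestor hp (par^[i₀] v₀) v
  obtain ⟨j, hj⟩ := Nat.find_spec hex
  rcases hi : Nat.find hex with _ | i
  · rw [hi] at hj
    exact Or.inl ⟨j, hj.symm⟩
  · rw [hi] at hj
    rcases j with _ | j
    · exact Or.inr ⟨i, hj.symm⟩
    · rw [Function.iterate_succ_apply' par j] at hj
      exact absurd ⟨j, (huniq i _ hj.symm).symm⟩ (Nat.find_min hex (m := i) (by omega))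

/-- The vertices which have `ω` as an ancestor, including `ω`. -/
def descendants (par : V → V) (ω : V) : Set V := {v | ∃ n, par^[n] v = ω}

lemma self_mem_descendants (par : V → V) (ω : V) : ω ∈ descendants par ω := ⟨0, rfl⟩

lemma parent_mem_descendants {ω v : V} (hv : v ∈ descendants par ω) (hne : v ≠ ω) :
    par v ∈ descendants par ω := by
  obtain ⟨_ | n, hn⟩ := hv
  · exact absurd hn hne
  · exact ⟨n, hn⟩

lemma mem_descendants_of_parent {ω v : V} (hv : par v ∈ descendants par ω) :
    v ∈ descendants par ω := by
  obtain ⟨n, hn⟩ := hv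
  exact ⟨n + 1, hn⟩

lemma IsGeneralizedRoot.iterate_notMem {ω : V} (hω : IsGeneralizedRoot par ω) (n : ℕ) :
    par^[n + 1] ω ∉ descendants par ω := by
  rintro ⟨k, hk⟩
  rw [← Function.iterate_add_apply] at hk
  exact hω.iterate_ne (k + n) hk

lemma IsGeneralizedRoot.parent_notMem {ω : V} (hω : IsGeneralizedRoot par ω) :
    par ω ∉ descendants par ω := hω.iterate_notMem 0

end Trees

/-! ### The shift in coordinates and subspaces of supported functions -/

section Shift

variable {V : Type*} {G : Digraph V} {par : V → V} {lam : V → ℝ} {S : L2 V →L[ℂ] L2 V}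

lemma IsWeightedShift.apply (hS : IsWeightedShift G lam S) (hp : IsParentMap G par) (f : L2 V)
    (v : V) : S f v = lam v * f (par v) := by
  have h : ∃ u, G.Adj u v := ⟨par v, (hp _ _).2 rfl⟩
  rw [hS, shiftFun, dif_pos h, (hp _ _).1 h.choose_spec]

open Classical in
/-- The indicator function of the vertex `v`. -/
noncomputable def basisVec (v : V) : L2 V := lp.single 2 v 1

@[simp]
lemma basisVec_apply_self (v : V) : basisVec v v = 1 := by
  simp [basisVec]

lemma basisVec_apply_of_ne {v w : V} (h : w ≠ v) : basisVec v w = 0 := by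
  simp [basisVec, h]

lemma inner_basisVec_left (v : V) (f : L2 V) : inner ℂ (basisVec v) f = f v := by
  classical
  simp [basisVec, lp.inner_single_left]

lemma inner_basisVec_right (v : V) (f : L2 V) :
    inner ℂ f (basisVec v) = starRingEnd ℂ (f v) := by
  rw [← inner_conj_symm, inner_basisVec_left]

/-- The functions in `ℓ²(V)` that vanish outside `W`. -/
def supportedOn (W : Set V) : Submodule ℂ (L2 V) where
  carrier := {f | ∀ v ∉ W, f v = 0}
  add_mem' := fun {f g} hf hg v hv => by simp [hf v hv, hg v hv]
  zero_mem' := fun v _ => rfl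
  smul_mem' := fun a f hf v hv => by simp [hf v hv]

lemma mem_supportedOn {W : Set V} {f : L2 V} : f ∈ supportedOn W ↔ ∀ v ∉ W, f v = 0 := Iff.rfl

lemma isClosed_supportedOn (W : Set V) : IsClosed (supportedOn W : Set (L2 V)) := by
  have h : (supportedOn W : Set (L2 V)) =
      ⋂ v ∈ Wᶜ, {f | lp.evalCLM ℂ (fun _ : V => ℂ) 2 v f = 0} := by
    ext f
    simp only [SetLike.mem_coe, mem_supportedOn, Set.mem_iInter, Set.mem_compl_iff]
    rfl
  rw [h]
  exact isClosed_biInter fun v _ => isClosed_eq (ContinuousLinearMap.continuous _) continuous_const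

instance (W : Set V) : CompleteSpace (supportedOn W) := (isClosed_supportedOn W).completeSpace_coe

lemma basisVec_mem_supportedOn {W : Set V} {v : V} (hv : v ∈ W) : basisVec v ∈ supportedOn W :=
  fun _ hw => basisVec_apply_of_ne fun h => hw (h ▸ hv)

lemma basisVec_mem_orthogonal {W : Set V} {v : V} (hv : v ∉ W) :
    basisVec v ∈ (supportedOn W)ᗮ := fun f hf => by
  rw [inner_basisVec_right, hf v hv, map_zero]

lemma apply_eq_zero_of_mem_orthogonal {W : Set V} {f : L2 V} (hf : f ∈ (supportedOn W)ᗮ) {v : V}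
    (hv : v ∈ W) : f v = 0 := by
  rw [← inner_basisVec_left]
  exact hf _ (basisVec_mem_supportedOn hv)

lemma orthogonalProjectionOnto_supportedOn_apply {W : Set V} (f : L2 V) {v : V} (hv : v ∈ W) :
    ((supportedOn W).orthogonalProjectionOnto f : L2 V) v = f v := by
  have h := apply_eq_zero_of_mem_orthogonal
    ((supportedOn W).sub_starProjection_mem_orthogonal f) hv
  rw [lp.coeFn_sub, Pi.sub_apply, sub_eq_zero] at h
  exact h.symm

end Shift

end RootlessShift

namespace RootlessShift

open ContinuousLinearMap

/-! ### Compressions and the block form of an invariant subspace -/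

section Compression

variable {L : Type*} [NormedAddCommGroup L] [InnerProductSpace ℂ L]
  (M : Submodule ℂ L) [M.HasOrthogonalProjection]

/-- The compression of the operator `T` to the subspace `M`. -/
noncomputable def compression (T : L →L[ℂ] L) : M →L[ℂ] M :=
  M.orthogonalProjectionOnto ∘L T ∘L M.subtypeL

lemma compression_apply (T : L →L[ℂ] L) (x : M) :
    compression M T x = M.orthogonalProjectionOnto (T x) := rfl

lemma compression_apply_of_eq {T : L →L[ℂ] L} {x y : M} (h : T x = y) :
    compression M T x = y := by
  rw [compression_apply, h, Submodule.orthogonalProjectionOnto_mem_subspace_eq_self]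

/-- The decomposition of an operator with respect to an invariant subspace. -/
lemma unitarilyEquivalent_blockUpper {S : L →L[ℂ] L} (hM : ∀ x ∈ M, S x ∈ M) :
    UnitarilyEquivalent S (blockUpper (compression M S)
      (M.orthogonalProjectionOnto ∘L S ∘L Mᗮ.subtypeL) (compression Mᗮ S)) := by
  refine ⟨M.orthogonalDecomposition, fun x => ?_⟩
  have hx : S x = S (M.orthogonalProjectionOnto x) + S (Mᗮ.orthogonalProjectionOnto x) := by
    rw [← map_add]
    congr 1
    exact (M.starProjection_add_starProjection_orthogonal x).symm
  have h₂ : Mᗮ.orthogonalProjectionOnto (S (M.orthogonalProjectionOnto x)) = 0 :=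
    Submodule.orthogonalProjectionOnto_eq_zero_iff.2
      (M.le_orthogonal_orthogonal (hM _ (M.orthogonalProjectionOnto x).2))
  apply prodLp_ext
  · simp only [Submodule.fst_orthogonalDecomposition_apply, fst_blockUpper_apply,
      Submodule.snd_orthogonalDecomposition_apply]
    rw [hx, map_add]
    rfl
  · simp only [snd_blockUpper_apply, Submodule.snd_orthogonalDecomposition_apply]
    rw [hx, map_add, h₂, zero_add]
    rfl

end Compression

/-! ### Construction of the analytic model -/

section Existence

variable {V : Type*} {G : Digraph V} {par : V → V} {lam : V → ℝ} {S Q : L2 V →L[ℂ] L2 V} {ω : V}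

lemma IsWeightedShift.mem_supportedOn_descendants (hS : IsWeightedShift G lam S)
    (hp : IsParentMap G par) {f : L2 V} (hf : f ∈ supportedOn (descendants par ω)) :
    S f ∈ supportedOn (descendants par ω) := fun v hv => by
  rw [hS.apply hp, hf _ fun h => hv (mem_descendants_of_parent h), mul_zero]

/-- The shift maps the basis vector of a proper ancestor of a generalized root to a multiple of
the basis vector of its only child. -/
lemma IsWeightedShift.apply_basisVec (hS : IsWeightedShift G lam S)
    (hp : IsParentMap G par) (hω : IsGeneralizedRoot par ω) (n : ℕ) :
    S (basisVec (par^[n + 1] ω)) = (lam (par^[n] ω) : ℂ) • basisVec (par^[n] ω) := by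
  ext v
  rw [hS.apply hp, lp.coeFn_smul, Pi.smul_apply, smul_eq_mul]
  by_cases hv : v = par^[n] ω
  · rw [hv, ← Function.iterate_succ_apply' par, basisVec_apply_self, basisVec_apply_self]
  · rw [basisVec_apply_of_ne hv, basisVec_apply_of_ne fun h => hv (hω.eq_of_parent_eq n v h),
      mul_zero, mul_zero]

lemma IsWeightedShift.leftInverse_apply_basisVec (hS : IsWeightedShift G lam S)
    (hp : IsParentMap G par) (hω : IsGeneralizedRoot par ω) (hlam : ∀ v, 0 < lam v)
    (hQ : ∀ f, Q (S f) = f) (n : ℕ) :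
    Q (basisVec (par^[n] ω)) = (lam (par^[n] ω) : ℂ)⁻¹ • basisVec (par^[n + 1] ω) := by
  have h := hQ (basisVec (par^[n + 1] ω))
  have hne : (lam (par^[n] ω) : ℂ) ≠ 0 := by exact_mod_cast (hlam _).ne'
  rw [hS.apply_basisVec hp hω, map_smul] at h
  rw [← h, smul_smul, inv_mul_cancel₀ hne, one_smul]

/-- The basis vectors of the proper ancestors of a generalized root. -/
noncomputable def ancestorVec (hω : IsGeneralizedRoot par ω) (n : ℕ) :
    ((supportedOn (descendants par ω))ᗮ : Submodule ℂ (L2 V)) :=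
  ⟨basisVec (par^[n + 1] ω), basisVec_mem_orthogonal (hω.iterate_notMem n)⟩

lemma inner_ancestorVec_left (hω : IsGeneralizedRoot par ω) (n : ℕ)
    (k : ((supportedOn (descendants par ω))ᗮ : Submodule ℂ (L2 V))) :
    inner ℂ (ancestorVec hω n) k = (k : L2 V) (par^[n + 1] ω) :=
  inner_basisVec_left _ _

lemma eq_zero_of_inner_ancestorVec (hω : IsGeneralizedRoot par ω)
    {k : ((supportedOn (descendants par ω))ᗮ : Submodule ℂ (L2 V))}
    (h : ∀ n, inner ℂ (ancestorVec hω n) k = 0) : k = 0 := by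
  ext v
  rcases hω.cover v with hv | ⟨n, rfl⟩
  · exact apply_eq_zero_of_mem_orthogonal k.2 hv
  · rw [← inner_ancestorVec_left hω, h]
    rfl

lemma IsWeightedShift.compression_ancestorVec_succ (hS : IsWeightedShift G lam S)
    (hp : IsParentMap G par) (hω : IsGeneralizedRoot par ω) (n : ℕ) :
    compression (supportedOn (descendants par ω))ᗮ S (ancestorVec hω (n + 1)) =
      (lam (par^[n + 1] ω) : ℂ) • ancestorVec hω n :=
  compression_apply_of_eq _ (hS.apply_basisVec hp hω (n + 1))

lemma IsWeightedShift.compression_ancestorVec_zero (hS : IsWeightedShift G lam S)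
    (hp : IsParentMap G par) (hω : IsGeneralizedRoot par ω) :
    compression (supportedOn (descendants par ω))ᗮ S (ancestorVec hω 0) = 0 := by
  have h : S (ancestorVec hω 0) ∈ supportedOn (descendants par ω) := by
    rw [show S (ancestorVec hω 0) = _ from hS.apply_basisVec hp hω 0]
    exact Submodule.smul_mem _ _ (basisVec_mem_supportedOn (self_mem_descendants par ω))
  rw [compression_apply]
  exact Submodule.orthogonalProjectionOnto_eq_zero_iff.2 (Submodule.le_orthogonal_orthogonal _ h)

lemma IsWeightedShift.compression_leftInverse_ancestorVec (hS : IsWeightedShift G lam S)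
    (hp : IsParentMap G par) (hω : IsGeneralizedRoot par ω) (hlam : ∀ v, 0 < lam v)
    (hQ : ∀ f, Q (S f) = f) (n : ℕ) :
    compression (supportedOn (descendants par ω))ᗮ Q (ancestorVec hω n) =
      (lam (par^[n + 1] ω) : ℂ)⁻¹ • ancestorVec hω (n + 1) :=
  compression_apply_of_eq _ (hS.leftInverse_apply_basisVec hp hω hlam hQ (n + 1))

/-- The corner of the shift with respect to the descendants of a generalized root. -/
lemma IsWeightedShift.corner_eq_rankOne (hS : IsWeightedShift G lam S)
    (hp : IsParentMap G par) (hω : IsGeneralizedRoot par ω) :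
    (supportedOn (descendants par ω)).orthogonalProjectionOnto ∘L S ∘L
        (supportedOn (descendants par ω))ᗮ.subtypeL =
      InnerProductSpace.rankOne ℂ ((lam ω : ℂ) •
        (⟨basisVec ω, basisVec_mem_supportedOn (self_mem_descendants par ω)⟩ :
          supportedOn (descendants par ω))) (ancestorVec hω 0) := by
  ext k v
  rw [InnerProductSpace.rankOne_apply, inner_ancestorVec_left]
  change ((supportedOn (descendants par ω)).orthogonalProjectionOnto (S k) : L2 V) v =
    (k : L2 V) (par ω) * (lam ω * basisVec ω v)
  by_cases hv : v ∈ descendants par ω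
  · rw [orthogonalProjectionOnto_supportedOn_apply _ hv, hS.apply hp]
    -- Only ω has its parent outside the descendants; at any other descendant, `S k` reads a value
    -- of `k` inside, which is zero.
    by_cases hvω : v = ω
    · subst hvω
      rw [basisVec_apply_self]
      ring
    · rw [apply_eq_zero_of_mem_orthogonal k.2 (parent_mem_descendants hv hvω),
        basisVec_apply_of_ne hvω]
      ring
  · rw [basisVec_apply_of_ne fun h => hv (by rw [h]; exact self_mem_descendants par ω), mul_zero, mul_zero]
    exact ((supportedOn (descendants par ω)).orthogonalProjectionOnto (S k)).2 v hv

lemma IsWeightedShift.coe_compression (hS : IsWeightedShift G lam S) (hp : IsParentMap G par)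
    (x : supportedOn (descendants par ω)) :
    (compression (supportedOn (descendants par ω)) S x : L2 V) = S x :=
  congrArg Subtype.val (compression_apply_of_eq _
    (y := ⟨S x, hS.mem_supportedOn_descendants hp x.2⟩) rfl)

lemma IsWeightedShift.adjoint_compression_basisVec (hS : IsWeightedShift G lam S)
    (hp : IsParentMap G par) (hω : IsGeneralizedRoot par ω) :
    adjoint (compression (supportedOn (descendants par ω)) S)
      ⟨basisVec ω, basisVec_mem_supportedOn (self_mem_descendants par ω)⟩ = 0 := by
  refine ext_inner_left ℂ fun x => ?_
  rw [adjoint_inner_right, inner_zero_right, Submodule.coe_inner, inner_basisVec_right,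
    hS.coe_compression hp, hS.apply hp, x.2 _ hω.parent_notMem, mul_zero, map_zero]

/-- Each application of the shift pushes the support one generation further below ω. Hence no
non-zero vector lies in the range of every power, which is the analyticity needed for the
realization. -/
lemma IsWeightedShift.compression_pow_apply_eq_zero (hS : IsWeightedShift G lam S)
    (hp : IsParentMap G par) (hω : IsGeneralizedRoot par ω) (n : ℕ)
    (x : supportedOn (descendants par ω)) {d : ℕ} (hd : d < n) {v : V} (hv : par^[d] v = ω) :
    ((compression (supportedOn (descendants par ω)) S ^ n) x : L2 V) v = 0 := by
  induction n generalizing d v with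
  | zero => omega
  | succ n ih =>
    rw [pow_succ']
    change (compression _ S ((compression _ S ^ n) x) : L2 V) v = 0
    rw [hS.coe_compression hp, hS.apply hp]
    rcases d with _ | d
    · obtain rfl : v = ω := hv
      rw [((compression (supportedOn (descendants par v)) S ^ n) x).2 _ hω.parent_notMem,
        mul_zero]
    · rw [ih (d := d) (by omega) hv, mul_zero]

lemma eq_pow_apply_pow_of_forall {H : Type*} [NormedAddCommGroup H] [InnerProductSpace ℂ H]
    {T L : H →L[ℂ] H} {h : H} (hTL : ∀ n : ℕ, (L ^ n) h = T (L ((L ^ n) h))) (n : ℕ) :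
    h = (T ^ n) ((L ^ n) h) := by
  induction n with
  | zero => rfl
  | succ n ih =>
    rw [pow_succ, pow_succ']
    change h = (T ^ n) (T (L ((L ^ n) h)))
    rw [← hTL, ← ih]

/-- The restriction of the shift to the descendants of a generalized root is the multiplication
by the coordinate on a Hilbert space of vector-valued holomorphic functions. -/
lemma IsWeightedShift.exists_realization_descendants (hS : IsWeightedShift G lam S)
    (hp : IsParentMap G par) (hω : IsGeneralizedRoot par ω) (hQ : ∀ f, Q (S f) = f) :
    ∃ (r : ℝ) (ρ : HolomorphicRealization (supportedOn (descendants par ω))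
      (supportedOn (descendants par ω)) 0 r), ρ.HasBoundedEvaluations ∧
      ρ.IsMulCoord (compression (supportedOn (descendants par ω)) S) := by
  set M := supportedOn (descendants par ω)
  set T := compression M S
  set L := compression M Q
  have hLT : ∀ x, L (T x) = x := fun x => compression_apply_of_eq _ (by
    rw [hS.coe_compression hp, hQ])
  refine ⟨_, resolventRealization L (ContinuousLinearMap.id ℂ M - T ∘L L) ?_,
    resolventRealization_hasBoundedEvaluations _ _ _,
    resolventRealization_isMulCoord _ _ _ hLT fun x => ?_⟩
  · intro h hh
    -- Vanishing of `(1 - T L) L ^ n h` for all `n` gives `h = T ^ n L ^ n h`. At depth `d` below ω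
    -- the power `d + 1` then forces the value zero.
    have hpow := eq_pow_apply_pow_of_forall (T := T) (L := L) (h := h) fun n =>
      sub_eq_zero.1 (hh n)
    ext v
    by_cases hv : v ∈ descendants par ω
    · obtain ⟨d, hd⟩ := hv
      rw [hpow (d + 1)]
      exact hS.compression_pow_apply_eq_zero hp hω (d + 1) _ d.lt_succ_self hd
    · exact h.2 v hv
  · change T x - T (L (T x)) = 0
    rw [hLT, sub_self]

/-- The adjoint of the compression of the shift to the proper ancestors of a generalized root is
the multiplication by the coordinate on a Hilbert space of scalar holomorphic functions. -/
lemma IsWeightedShift.exists_realization_ancestors (hS : IsWeightedShift G lam S)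
    (hp : IsParentMap G par) (hω : IsGeneralizedRoot par ω) (hlam : ∀ v, 0 < lam v)
    (hQ : ∀ f, Q (S f) = f) :
    ∃ (s : ℝ) (τ : HolomorphicRealization ℂ
      ((supportedOn (descendants par ω))ᗮ : Submodule ℂ (L2 V)) 0 s),
      τ.HasBoundedEvaluations ∧
      τ.IsMulCoord (adjoint (compression (supportedOn (descendants par ω))ᗮ S)) := by
  set N := (supportedOn (descendants par ω))ᗮ
  set B := compression N S
  set W := compression N Q
  have hne : ∀ v, (lam v : ℂ) ≠ 0 := fun v => by exact_mod_cast (hlam v).ne'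
  have hW := hS.compression_leftInverse_ancestorVec hp hω hlam hQ
  -- On the ancestor vectors `B` is a backward shift and `W` the forward shift with inverse weights.
  -- So `B W = 1`, that is `W* B* = 1`, and `B` kills the vector paired with in `P`, so `P B* = 0`.
  refine ⟨_, resolventRealization (adjoint W) (innerSL ℂ (ancestorVec hω 0)) ?_,
    resolventRealization_hasBoundedEvaluations _ _ _,
    resolventRealization_isMulCoord _ _ _ (fun h => ?_) fun h => ?_⟩
  · intro h hh
    refine eq_zero_of_inner_ancestorVec hω fun n => ?_
    induction n generalizing h with
    | zero => exact hh 0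
    | succ n ih =>
      -- The coefficients of `W* h` are those of `h` moved by one, and its `n`-th coordinate is a
      -- non-zero multiple of the next coordinate of `h`.
      have h₁ : inner ℂ (ancestorVec hω n) (adjoint W h) = 0 := ih _ fun i => by
        have := hh (i + 1)
        rw [pow_succ] at this
        exact this
      rw [adjoint_inner_right, hW, inner_smul_left] at h₁
      exact (mul_eq_zero.1 h₁).resolve_left ((map_ne_zero _).2 (inv_ne_zero (hne _)))
  · rw [← sub_eq_zero]
    refine eq_zero_of_inner_ancestorVec hω fun n => ?_
    rw [inner_sub_right, adjoint_inner_right, adjoint_inner_right, hW, map_smul,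
      hS.compression_ancestorVec_succ hp hω, smul_smul, inv_mul_cancel₀ (hne _), one_smul, sub_self]
  · rw [innerSL_apply_apply, adjoint_inner_right, hS.compression_ancestorVec_zero hp hω,
      inner_zero_left]

end Existence

end RootlessShift

theorem mainTheorem9 {V : Type u} [Countable V] (G : Digraph V)
    (hT : RootlessShift.IsDirectedTree G) (hleafless : RootlessShift.IsLeafless G)
    (hrootless : RootlessShift.IsRootless G)
    (hbranch : (RootlessShift.branchingSet G).Nonempty)
    (hfin : RootlessShift.HasFiniteBranchingIndex G)
    (lam : V → ℝ) (hlam : ∀ v, 0 < lam v)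
    (S : RootlessShift.L2 V →L[ℂ] RootlessShift.L2 V)
    (hS : RootlessShift.IsWeightedShift G lam S)
    (hleft : RootlessShift.IsLeftInvertible S) :
    -- an analytic model exists, on reproducing kernel Hilbert spaces over discs centred at `0`
    (∃ (E H K : Type u)
      (_ : NormedAddCommGroup E) (_ : InnerProductSpace ℂ E) (_ : CompleteSpace E)
      (_ : NormedAddCommGroup H) (_ : InnerProductSpace ℂ H) (_ : CompleteSpace H)
      (_ : NormedAddCommGroup K) (_ : InnerProductSpace ℂ K) (_ : CompleteSpace K)
      (r s : ℝ) (ρ : RootlessShift.HolomorphicRealization E H 0 r)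
      (τ : RootlessShift.HolomorphicRealization ℂ K 0 s)
      (Mz : H →L[ℂ] H) (Mt : K →L[ℂ] K) (f : H) (g : K),
      ρ.HasBoundedEvaluations ∧ τ.HasBoundedEvaluations ∧
      RootlessShift.IsAnalyticModel S ρ τ Mz Mt f g) ∧
    -- and every analytic model has the asserted properties
    (∀ (E : Type v₁) (H : Type v₂) (K : Type v₃)
      [NormedAddCommGroup E] [InnerProductSpace ℂ E] [CompleteSpace E]
      [NormedAddCommGroup H] [InnerProductSpace ℂ H] [CompleteSpace H]
      [NormedAddCommGroup K] [InnerProductSpace ℂ K] [CompleteSpace K]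
      (c d : ℂ) (r s : ℝ) (ρ : RootlessShift.HolomorphicRealization E H c r)
      (τ : RootlessShift.HolomorphicRealization ℂ K d s)
      (Mz : H →L[ℂ] H) (Mt : K →L[ℂ] K) (f : H) (g : K),
      RootlessShift.IsAnalyticModel S ρ τ Mz Mt f g →
      RootlessShift.essentialSpectrum S =
        RootlessShift.essentialSpectrum Mz ∪
          RootlessShift.essentialSpectrum (ContinuousLinearMap.adjoint Mt) ∧
      (S.IsFredholm →
        Mz.IsFredholm ∧ Mt.IsFredholm ∧
        RootlessShift.fredholmIndex S = RootlessShift.fredholmIndex Mz + 1)) := by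
  obtain ⟨Q, hQ⟩ := hleft
  have hQS : ∀ f, Q (S f) = f := fun f => congrArg (fun T => T f) hQ
  refine ⟨?_, fun E H K _ _ _ _ _ _ _ _ _ c d r s ρ τ Mz Mt f g h =>
    ⟨h.essentialSpectrum_eq, fun hF => ⟨(h.isFredholm_iff.1 hF).1, (h.isFredholm_iff.1 hF).2,
      h.fredholmIndex_eq (Function.LeftInverse.injective hQS) hF⟩⟩⟩
  obtain ⟨par, hp⟩ := hT.exists_isParentMap hrootless
  obtain ⟨ω, hω⟩ := hT.exists_isGeneralizedRoot hp hbranch hfin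
  obtain ⟨r, ρ, hρ, hMz⟩ := hS.exists_realization_descendants hp hω hQS
  obtain ⟨s, τ, hτ, hMt⟩ := hS.exists_realization_ancestors hp hω hlam hQS
  let M := RootlessShift.supportedOn (RootlessShift.descendants par ω)
  let e : M := ⟨RootlessShift.basisVec ω,
    RootlessShift.basisVec_mem_supportedOn (RootlessShift.self_mem_descendants par ω)⟩
  have hlamω : (lam ω : ℂ) ≠ 0 := by exact_mod_cast (hlam ω).ne'
  -- The coefficient space is all of `M`, since `1 - T L` takes values there. `Mt` is the adjoint of
  -- the compression to `Mᗮ`, so that `Mt*` is the compression itself.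
  refine ⟨M, M, (Mᗮ : Submodule ℂ (RootlessShift.L2 V)), inferInstance, inferInstance,
    inferInstance, inferInstance, inferInstance, inferInstance, inferInstance, inferInstance,
    inferInstance, r, s, ρ, τ, RootlessShift.compression M S,
    ContinuousLinearMap.adjoint (RootlessShift.compression Mᗮ S), (lam ω : ℂ) • e,
    RootlessShift.ancestorVec hω 0, hρ, hτ, hMz, hMt, ?_, ?_, ?_, ?_, ?_⟩
  · refine smul_ne_zero hlamω fun h => ?_
    have := congrArg (fun x : M => (x : RootlessShift.L2 V) ω) h
    simp [e] at this
  · rw [map_smul, hS.adjoint_compression_basisVec hp hω, smul_zero]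
  · intro h
    have := congrArg (fun x : (Mᗮ : Submodule ℂ (RootlessShift.L2 V)) =>
      (x : RootlessShift.L2 V) (par^[0 + 1] ω)) h
    simp [RootlessShift.ancestorVec] at this
  · rw [ContinuousLinearMap.adjoint_adjoint]
    exact hS.compression_ancestorVec_zero hp hω
  · rw [ContinuousLinearMap.adjoint_adjoint, ← hS.corner_eq_rankOne hp hω]
    exact RootlessShift.unitarilyEquivalent_blockUpper M fun x hx =>
      hS.mem_supportedOn_descendants hp hx
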